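/- Let $\mathcal{L}_{\mathsf B}$ be the first-order language with equality, the relation symbol $\le$, the constants $0,1$ and the function symbols $S$ (successor), $+$, $\cdot$, $\lfloor x/2\rfloor$, $|x|$ and $\#$ (whose standard interpretations on $\mathbb N$ include: $|x|$ is the binary length of $x$, and $x\# y=2^{|x|\cdot|y|}$). The theory $\mathsf S^1_2$ consists of Buss's finite set $\mathsf{BASIC}$ of universal axioms together with the polynomial induction axioms $\varphi(0)\wedge\forall x\,(\varphi(\lfloor x/2\rfloor)\rightarrow\varphi(x))\rightarrow\forall x\,\varphi(x)$ for all $\Sigma^b_1$-formulas $\varphi$ (possibly with parameters). An element of a model is *nonstandard* if it is not the value of a numeral $S^k0$, $k\in\mathbb N$, and a model is nonstandard if it has a nonstandard element. A *cut* of a model $M_0$ is a nonempty set $I\subseteq M_0$ such that $a<b\in I$ implies $a\in I$, and $a\in I$ implies $a+1\in I$. **Lemma.** Let $M_0$ be a nonstandard countable model of $\mathsf S^1_2$. Then there are a (countable) cut $M$ of $M_0$ which, with the operations and the relation inherited from $M_0$, is a model of $\mathsf S^1_2$, and a length $n\in M$, where $n=|e|$ for some nonstandard $e\in M$, such that for every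 $b\in M$ there is a standard number $k\in\mathbb N$ with $M\models |b|\le n^k$. -/

import Mathlib

open FirstOrder FirstOrder.Language

namespace BoundedArithmetic

/-! ### The language of bounded arithmetic -/

/-- Function symbols `0`, `1`, `S`, `⌊x/2⌋`, `|x|`, `+`, `·`, `#`. -/
inductive LBFunc : ℕ → Type
  | zero : LBFunc 0
  | one : LBFunc 0
  | succ : LBFunc 1
  | half : LBFunc 1
  | len : LBFunc 1
  | add : LBFunc 2
  | mul : LBFunc 2
  | smash : LBFunc 2

/-- The only relation symbol besides equality is `≤`. -/
inductive LBRel : ℕ → Type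
  | le : LBRel 2

/-- The first-order language of Buss's theories. -/
abbrev LB : FirstOrder.Language.{0, 0} where
  Functions := LBFunc
  Relations := LBRel

section Formulas

variable {α : Type*} {n : ℕ}

instance : Zero (LB.Term α) := ⟨Constants.term (L := LB) LBFunc.zero⟩
instance : One (LB.Term α) := ⟨Constants.term (L := LB) LBFunc.one⟩
instance : Add (LB.Term α) := ⟨Functions.apply₂ (L := LB) LBFunc.add⟩
instance : Mul (LB.Term α) := ⟨Functions.apply₂ (L := LB) LBFunc.mul⟩

/-- The term `S t`. -/
def tSucc (t : LB.Term α) : LB.Term α := Functions.apply₁ (L := LB) LBFunc.succ t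
/-- The term `⌊t/2⌋`. -/
def tHalf (t : LB.Term α) : LB.Term α := Functions.apply₁ (L := LB) LBFunc.half t
/-- The term `|t|`. -/
def tLen (t : LB.Term α) : LB.Term α := Functions.apply₁ (L := LB) LBFunc.len t
/-- The term `s # t`. -/
def tSmash (s t : LB.Term α) : LB.Term α := Functions.apply₂ (L := LB) LBFunc.smash s t
/-- The numeral `2`. -/
def tTwo : LB.Term α := tSucc (tSucc 0)

/-- The atomic formula `s ≤ t`. -/
def fLe (s t : LB.Term (α ⊕ Fin n)) : LB.BoundedFormula α n :=
  Relations.boundedFormula₂ (L := LB) LBRel.le s t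

/-- The bound of a quantifier: `y ≤ t`, where `y` is the newly bound variable (the last one) and
`t` is a term in the other variables only. -/
def fBound (t : LB.Term (α ⊕ Fin n)) : LB.BoundedFormula α (n + 1) :=
  fLe (Term.var (Sum.inr (Fin.last n))) (t.relabel (Sum.map id Fin.castSucc))

/-- The bounded quantifier `∀ y ≤ t, φ`. -/
def bAll (t : LB.Term (α ⊕ Fin n)) (φ : LB.BoundedFormula α (n + 1)) : LB.BoundedFormula α n :=
  ((fBound t).imp φ).all

/-- The bounded quantifier `∃ y ≤ t, φ`. -/
def bEx (t : LB.Term (α ⊕ Fin n)) (φ : LB.BoundedFormula α (n + 1)) : LB.BoundedFormula α n :=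
  (fBound t ⊓ φ).ex

end Formulas

/-! ### Sharply bounded formulas and the first level of the bounded hierarchy -/

/-- Sharply bounded formulas: the class `Σᵇ₀ = Πᵇ₀`. -/
inductive IsSharplyBounded {α : Type} : ∀ {n : ℕ}, LB.BoundedFormula α n → Prop
  | falsum {n : ℕ} : IsSharplyBounded (⊥ : LB.BoundedFormula α n)
  | equal {n : ℕ} (s t : LB.Term (α ⊕ Fin n)) : IsSharplyBounded (s.bdEqual t)
  | le {n : ℕ} (s t : LB.Term (α ⊕ Fin n)) : IsSharplyBounded (fLe s t)
  | not {n : ℕ} {φ : LB.BoundedFormula α n} : IsSharplyBounded φ → IsSharplyBounded φ.not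
  | and {n : ℕ} {φ ψ : LB.BoundedFormula α n} :
      IsSharplyBounded φ → IsSharplyBounded ψ → IsSharplyBounded (φ ⊓ ψ)
  | or {n : ℕ} {φ ψ : LB.BoundedFormula α n} :
      IsSharplyBounded φ → IsSharplyBounded ψ → IsSharplyBounded (φ ⊔ ψ)
  | imp {n : ℕ} {φ ψ : LB.BoundedFormula α n} :
      IsSharplyBounded φ → IsSharplyBounded ψ → IsSharplyBounded (φ.imp ψ)
  | sharpAll {n : ℕ} (t : LB.Term (α ⊕ Fin n)) {φ : LB.BoundedFormula α (n + 1)} :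
      IsSharplyBounded φ → IsSharplyBounded (bAll (tLen t) φ)
  | sharpEx {n : ℕ} (t : LB.Term (α ⊕ Fin n)) {φ : LB.BoundedFormula α (n + 1)} :
      IsSharplyBounded φ → IsSharplyBounded (bEx (tLen t) φ)

/-- The two sides `Σ` and `Π` of the bounded hierarchy. -/
inductive Side
  | sigma
  | pi

/-- Exchange `Σ` and `Π`. -/
def Side.dual : Side → Side
  | .sigma => .pi
  | .pi => .sigma

/-- `InLevelOne .sigma φ` says that `φ` is a `Σᵇ₁`-formula, `InLevelOne .pi φ` that it is a
`Πᵇ₁`-formula: these are the least classes that contain the sharply bounded formulas, are closed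
under `∧`, `∨` and sharply bounded quantifiers, where `Σᵇ₁` is closed under bounded existential
and `Πᵇ₁` under bounded universal quantification, and where negation (and the antecedent of an
implication) exchanges the two classes. -/
inductive InLevelOne {α : Type} : Side → ∀ {n : ℕ}, LB.BoundedFormula α n → Prop
  | ofSharplyBounded {s : Side} {n : ℕ} {φ : LB.BoundedFormula α n} :
      IsSharplyBounded φ → InLevelOne s φ
  | not {s : Side} {n : ℕ} {φ : LB.BoundedFormula α n} :
      InLevelOne s.dual φ → InLevelOne s φ.not
  | and {s : Side} {n : ℕ} {φ ψ : LB.BoundedFormula α n} :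
      InLevelOne s φ → InLevelOne s ψ → InLevelOne s (φ ⊓ ψ)
  | or {s : Side} {n : ℕ} {φ ψ : LB.BoundedFormula α n} :
      InLevelOne s φ → InLevelOne s ψ → InLevelOne s (φ ⊔ ψ)
  | imp {s : Side} {n : ℕ} {φ ψ : LB.BoundedFormula α n} :
      InLevelOne s.dual φ → InLevelOne s ψ → InLevelOne s (φ.imp ψ)
  | sharpAll {s : Side} {n : ℕ} (t : LB.Term (α ⊕ Fin n)) {φ : LB.BoundedFormula α (n + 1)} :
      InLevelOne s φ → InLevelOne s (bAll (tLen t) φ)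
  | sharpEx {s : Side} {n : ℕ} (t : LB.Term (α ⊕ Fin n)) {φ : LB.BoundedFormula α (n + 1)} :
      InLevelOne s φ → InLevelOne s (bEx (tLen t) φ)
  | boundedEx {n : ℕ} (t : LB.Term (α ⊕ Fin n)) {φ : LB.BoundedFormula α (n + 1)} :
      InLevelOne .sigma φ → InLevelOne .sigma (bEx t φ)
  | boundedAll {n : ℕ} (t : LB.Term (α ⊕ Fin n)) {φ : LB.BoundedFormula α (n + 1)} :
      InLevelOne .pi φ → InLevelOne .pi (bAll t φ)

/-- `Σᵇ₁`-formulas. -/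
def IsSigmaB1 {α : Type} {n : ℕ} (φ : LB.BoundedFormula α n) : Prop := InLevelOne .sigma φ

/-! ### The theory `S¹₂` -/

/-- The variables `a, b, c, d` of the basic axioms. -/
def tVar (i : Fin 4) : LB.Term (Empty ⊕ Fin 4) := Term.var (Sum.inr i)

/-- Buss's list of basic axioms, in the variables `a, b, c, d` and without the outer universal
quantifiers; the first entry defines the constant `1`, which the language contains besides `S`. -/
def basicList : List (LB.BoundedFormula Empty 4) :=
  let a := tVar 0
  let b := tVar 1
  let c := tVar 2
  let d := tVar 3
  [ Term.bdEqual 1 (tSucc 0),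
    (fLe b a).imp (fLe b (tSucc a)),
    (a.bdEqual (tSucc a)).not,
    fLe 0 a,
    (fLe a b ⊓ (a.bdEqual b).not).iff (fLe (tSucc a) b),
    (a.bdEqual 0).not.imp ((tTwo * a).bdEqual 0).not,
    fLe a b ⊔ fLe b a,
    (fLe a b ⊓ fLe b a).imp (a.bdEqual b),
    (fLe a b ⊓ fLe b c).imp (fLe a c),
    (tLen 0).bdEqual 0,
    (a.bdEqual 0).not.imp ((tLen (tTwo * a)).bdEqual (tSucc (tLen a)) ⊓
      (tLen (tSucc (tTwo * a))).bdEqual (tSucc (tLen a))),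
    (tLen 1).bdEqual 1,
    (fLe a b).imp (fLe (tLen a) (tLen b)),
    (tLen (tSmash a b)).bdEqual (tSucc (tLen a * tLen b)),
    (tSmash 0 a).bdEqual 1,
    (a.bdEqual 0).not.imp ((tSmash 1 (tTwo * a)).bdEqual (tTwo * tSmash 1 a) ⊓
      (tSmash 1 (tSucc (tTwo * a))).bdEqual (tTwo * tSmash 1 a)),
    (tSmash a b).bdEqual (tSmash b a),
    ((tLen a).bdEqual (tLen b)).imp ((tSmash a c).bdEqual (tSmash b c)),
    ((tLen a).bdEqual (tLen b + tLen c)).imp ((tSmash a d).bdEqual (tSmash b d * tSmash c d)),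
    fLe a (a + b),
    (fLe a b ⊓ (a.bdEqual b).not).imp
      (fLe (tSucc (tTwo * a)) (tTwo * b) ⊓ ((tSucc (tTwo * a)).bdEqual (tTwo * b)).not),
    (a + b).bdEqual (b + a),
    (a + 0).bdEqual a,
    (a + tSucc b).bdEqual (tSucc (a + b)),
    ((a + b) + c).bdEqual (a + (b + c)),
    (fLe (a + b) (a + c)).iff (fLe b c),
    (a * 0).bdEqual 0,
    (a * tSucc b).bdEqual (a * b + a),
    (a * b).bdEqual (b * a),
    (a * (b + c)).bdEqual (a * b + a * c),
    (fLe 1 a).imp ((fLe (a * b) (a * c)).iff (fLe b c)),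
    (a.bdEqual 0).not.imp ((tLen a).bdEqual (tSucc (tLen (tHalf a)))),
    (a.bdEqual (tHalf b)).iff ((tTwo * a).bdEqual b ⊔ (tSucc (tTwo * a)).bdEqual b) ]

/-- The finite set `BASIC`: the universal closures of the basic axioms. -/
def BASIC : LB.Theory := {σ | ∃ ψ ∈ basicList, σ = ψ.alls}

/-- Regard the free variables of a formula as variables that can be quantified. -/
def openVars {k : ℕ} (φ : LB.Formula (Fin k)) : LB.BoundedFormula Empty k :=
  BoundedFormula.relabel (n := k) (k := 0) (fun i => Sum.inr i) φ

/-- The polynomial induction axiom for `φ`, on its last variable `x`; the other variables are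
parameters, which are quantified universally:
`φ(0) ∧ ∀ x (φ(⌊x/2⌋) → φ(x)) → ∀ x φ(x)`. -/
def pind {k : ℕ} (φ : LB.Formula (Fin (k + 1))) : LB.Sentence :=
  ((openVars (φ.subst (Fin.snoc (α := fun _ => LB.Term (Fin k)) Term.var 0)) ⊓
      ((openVars (φ.subst
          (Function.update Term.var (Fin.last k) (tHalf (Term.var (Fin.last k)))))).imp
        (openVars φ)).all).imp
    (openVars φ).all).alls

/-- The theory `S¹₂`: `BASIC` together with polynomial induction for `Σᵇ₁`-formulas. -/
def S12 : LB.Theory :=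
  BASIC ∪ {σ | ∃ (k : ℕ) (φ : LB.Formula (Fin (k + 1))), IsSigmaB1 φ ∧ σ = pind φ}

/-! ### Structures for the language, standard elements, cuts -/

section Structures

variable {M : Type*} [LB.Structure M]

/-- `0` in the structure `M`. -/
def zero (M : Type*) [LB.Structure M] : M := Structure.funMap (L := LB) LBFunc.zero ![]
/-- `1` in the structure `M`. -/
def one (M : Type*) [LB.Structure M] : M := Structure.funMap (L := LB) LBFunc.one ![]
/-- `S a` in the structure `M`. -/
def succ (a : M) : M := Structure.funMap (L := LB) LBFunc.succ ![a]
/-- `|a|` in the structure `M`. -/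
def len (a : M) : M := Structure.funMap (L := LB) LBFunc.len ![a]
/-- `a + b` in the structure `M`. -/
def add (a b : M) : M := Structure.funMap (L := LB) LBFunc.add ![a, b]
/-- `a · b` in the structure `M`. -/
def mul (a b : M) : M := Structure.funMap (L := LB) LBFunc.mul ![a, b]
/-- `a ≤ b` in the structure `M`. -/
def le (a b : M) : Prop := Structure.RelMap (L := LB) LBRel.le ![a, b]
/-- `a < b` in the structure `M`. -/
def lt (a b : M) : Prop := le a b ∧ a ≠ b

/-- `a ^ k` in the structure `M`, for a standard number `k`. -/
def pow (a : M) : ℕ → M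
  | 0 => one M
  | k + 1 => mul (pow a k) a

/-- The value `S (S (… 0))` of the standard number `k` in the structure `M`. -/
def numeral (M : Type*) [LB.Structure M] : ℕ → M
  | 0 => zero M
  | k + 1 => succ (numeral M k)

/-- An element is nonstandard if it is not the value of a standard number. -/
def IsNonstandard (e : M) : Prop := ∀ k : ℕ, e ≠ numeral M k

/-- A structure is nonstandard if it has a nonstandard element. -/
def IsNonstandardModel (M : Type*) [LB.Structure M] : Prop := ∃ e : M, IsNonstandard e

/-- A cut: a nonempty set that is closed downwards and under `a ↦ a + 1`. -/
structure IsCut (I : Set M) : Prop where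
  nonempty : I.Nonempty
  downward : ∀ a b : M, b ∈ I → lt a b → a ∈ I
  add_one_mem : ∀ a : M, a ∈ I → add a (one M) ∈ I

end Structures

end BoundedArithmetic

/-! Fix a nonstandard `e`, put `n = |e|`, and take as `M` all `b` with `|b| ≤ n^k` for some standard
`k`. The length bound then holds by construction, and `e` itself lies in `M`.

Closure under the operations rests on `2 ≤ n`, which absorbs successors: `n^k + 1 ≤ n^(k+1)`. Since
`|a # b| = |a|·|b| + 1`, the set is closed under `#`, and products follow from `a·b ≤ 2 # max(a, b)`
(`S12.mul_le_two_smash`). The arithmetic behind this that BASIC does not list comes from polynomial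
induction on open formulas.

A downward closed substructure agrees with the ambient model on bounded formulas
(`InLevelOne.isAbsolute`), so it inherits BASIC. For induction on `φ` up to a point `a` of the cut,
the ambient model is given induction for `x ≤ a → φ(x)`, which is again `Σᵇ₁` and speaks only of
elements of the cut (`models_S12_of_downward`). -/

open FirstOrder FirstOrder.Language

namespace BoundedArithmetic

/-! ### Semantics of terms, bounded quantifiers and the induction axioms. -/

section Semantics

variable {M : Type*} [LB.Structure M] {α : Type*} {n : ℕ}

@[simp] theorem realize_tZero (v : α → M) : (0 : LB.Term α).realize v = zero M := by
  refine (congrArg (Structure.funMap (L := LB) (M := M) LBFunc.zero) (Subsingleton.elim _ _))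

@[simp] theorem realize_tOne (v : α → M) : (1 : LB.Term α).realize v = one M := by
  refine (congrArg (Structure.funMap (L := LB) (M := M) LBFunc.one) (Subsingleton.elim _ _))

@[simp] theorem realize_tSucc (v : α → M) (t : LB.Term α) :
    (tSucc t).realize v = succ (t.realize v) :=
  Term.realize_functions_apply₁

@[simp] theorem realize_tHalf (v : α → M) (t : LB.Term α) :
    (tHalf t).realize v = Structure.funMap (L := LB) LBFunc.half ![t.realize v] :=
  Term.realize_functions_apply₁

@[simp] theorem realize_tLen (v : α → M) (t : LB.Term α) :
    (tLen t).realize v = len (t.realize v) :=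
  Term.realize_functions_apply₁

@[simp] theorem realize_tAdd (v : α → M) (s t : LB.Term α) :
    (s + t).realize v = add (s.realize v) (t.realize v) :=
  Term.realize_functions_apply₂

@[simp] theorem realize_tMul (v : α → M) (s t : LB.Term α) :
    (s * t).realize v = mul (s.realize v) (t.realize v) :=
  Term.realize_functions_apply₂

@[simp] theorem realize_tSmash (v : α → M) (s t : LB.Term α) :
    (tSmash s t).realize v =
      Structure.funMap (L := LB) LBFunc.smash ![s.realize v, t.realize v] :=
  Term.realize_functions_apply₂

@[simp] theorem realize_tTwo (v : α → M) :
    (tTwo : LB.Term α).realize v = succ (succ (zero M)) := by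
  simp [tTwo]

@[simp] theorem realize_fLe (s t : LB.Term (α ⊕ Fin n)) (v : α → M) (xs : Fin n → M) :
    (fLe s t).Realize v xs ↔
      le (s.realize (Sum.elim v xs)) (t.realize (Sum.elim v xs)) :=
  BoundedFormula.realize_rel₂

@[simp] theorem realize_fBound (t : LB.Term (α ⊕ Fin n)) (v : α → M) (xs : Fin n → M) (a : M) :
    (fBound t).Realize v (Fin.snoc xs a) ↔ le a (t.realize (Sum.elim v xs)) := by
  have : Sum.elim v (Fin.snoc (α := fun _ => M) xs a) ∘ Sum.map id Fin.castSucc =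
      Sum.elim v xs := by
    ext i; cases i <;> simp
  simp [fBound, this]

@[simp] theorem realize_bAll (t : LB.Term (α ⊕ Fin n)) (φ : LB.BoundedFormula α (n + 1))
    (v : α → M) (xs : Fin n → M) :
    (bAll t φ).Realize v xs ↔
      ∀ a, le a (t.realize (Sum.elim v xs)) → φ.Realize v (Fin.snoc xs a) := by
  simp [bAll]

@[simp] theorem realize_bEx (t : LB.Term (α ⊕ Fin n)) (φ : LB.BoundedFormula α (n + 1))
    (v : α → M) (xs : Fin n → M) :
    (bEx t φ).Realize v xs ↔
      ∃ a, le a (t.realize (Sum.elim v xs)) ∧ φ.Realize v (Fin.snoc xs a) := by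
  simp [bEx]

/-- `⌊a/2⌋` in the structure `M`. -/
def half (a : M) : M := Structure.funMap (L := LB) LBFunc.half ![a]

/-- `a # b` in the structure `M`. -/
def smash (a b : M) : M := Structure.funMap (L := LB) LBFunc.smash ![a, b]

theorem realize_openVars {k : ℕ} (φ : LB.Formula (Fin k)) (v : Empty → M) (xs : Fin k → M) :
    (openVars φ).Realize v xs ↔ φ.Realize xs := by
  unfold openVars
  rw [BoundedFormula.realize_relabel]
  have h : (Sum.elim v (xs ∘ Fin.castAdd 0) ∘ fun i => (Sum.inr i : Empty ⊕ Fin k)) = xs := by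
    ext i; simp
  rw [h]
  exact iff_of_eq (congrArg _ (Subsingleton.elim _ _))

/-- Replaces the syntactic substitutions of `0` and `⌊x/2⌋` by a change of the last coordinate of
the assignment. -/
theorem models_pind {k : ℕ} (φ : LB.Formula (Fin (k + 1))) :
    M ⊨ pind φ ↔ ∀ v : Fin k → M, φ.Realize (Fin.snoc v (zero M) : Fin (k + 1) → M) →
      (∀ x, φ.Realize (Fin.snoc v (half x) : Fin (k + 1) → M) →
        φ.Realize (Fin.snoc v x : Fin (k + 1) → M)) →
      ∀ x, φ.Realize (Fin.snoc v x : Fin (k + 1) → M) := by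
  have h0 (v : Fin k → M) : (fun a => Term.realize v
      ((Fin.snoc (α := fun _ => LB.Term (Fin k)) Term.var 0 : Fin (k + 1) → _) a)) =
      (Fin.snoc v (zero M) : Fin (k + 1) → M) := by
    ext i; refine Fin.lastCases ?_ (fun i => ?_) i <;> simp
  have h1 (v : Fin k → M) (x : M) : (fun a => Term.realize (Fin.snoc v x : Fin (k + 1) → M)
      ((Function.update Term.var (Fin.last k) (tHalf (Term.var (Fin.last k))) :
        Fin (k + 1) → LB.Term (Fin (k + 1))) a)) =
      (Fin.snoc v (half x) : Fin (k + 1) → M) := by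
    ext i; refine Fin.lastCases ?_ (fun i => ?_) i <;> simp [half]
  refine BoundedFormula.realize_alls.trans (forall_congr' fun v => ?_)
  simp only [BoundedFormula.realize_imp, BoundedFormula.realize_inf, BoundedFormula.realize_all,
    realize_openVars]
  simp only [Formula.Realize, BoundedFormula.realize_subst, h0, h1]
  exact and_imp

end Semantics

/-! ### Stability of the formula classes under substitution. -/

section Substitution

variable {α β : Type} {n : ℕ}

theorem subst_fLe (f : α → LB.Term β) (s t : LB.Term (α ⊕ Fin n)) :
    (fLe s t).subst f =
      fLe (s.subst (Sum.elim (Term.relabel Sum.inl ∘ f) (Term.var ∘ Sum.inr)))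
        (t.subst (Sum.elim (Term.relabel Sum.inl ∘ f) (Term.var ∘ Sum.inr))) := by
  simp only [fLe, Relations.boundedFormula₂, Relations.boundedFormula, BoundedFormula.subst,
    BoundedFormula.mapTermRel, id]
  congr 1
  ext i; fin_cases i <;> rfl

theorem subst_tLen {α β : Type*} (f : α → LB.Term β) (t : LB.Term α) :
    (tLen t).subst f = tLen (t.subst f) := by
  simp only [tLen, Functions.apply₁, Term.subst]
  congr 1
  ext i; fin_cases i; rfl

theorem subst_fBound (f : α → LB.Term β) (t : LB.Term (α ⊕ Fin n)) :
    (fBound t).subst f =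
      fBound (t.subst (Sum.elim (Term.relabel Sum.inl ∘ f) (Term.var ∘ Sum.inr))) := by
  rw [fBound, subst_fLe, fBound]
  congr 1
  induction t with
  | var i =>
    rcases i with i | i
    · simp only [Term.relabel, Term.subst, Sum.map_inl, Sum.elim_inl, Function.comp, id]
      rw [Term.relabel_relabel]; rfl
    · rfl
  | func g ts ih =>
    simp only [Term.relabel, Term.subst]
    congr 1
    ext i; exact ih i

theorem IsSharplyBounded.subst (f : α → LB.Term β) {φ : LB.BoundedFormula α n}
    (h : IsSharplyBounded φ) : IsSharplyBounded (φ.subst f) := by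
  induction h with
  | falsum => exact .falsum
  | equal s t => exact .equal _ _
  | le s t => rw [subst_fLe]; exact .le _ _
  | not _ ih => exact .not ih
  | and _ _ ih₁ ih₂ => exact .and ih₁ ih₂
  | or _ _ ih₁ ih₂ => exact .or ih₁ ih₂
  | imp _ _ ih₁ ih₂ => exact .imp ih₁ ih₂
  | sharpAll t _ ih =>
    have := IsSharplyBounded.sharpAll
      (t.subst (Sum.elim (Term.relabel Sum.inl ∘ f) (Term.var ∘ Sum.inr))) ih
    rw [← subst_tLen, bAll, ← subst_fBound] at this
    exact this
  | sharpEx t _ ih =>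
    have := IsSharplyBounded.sharpEx
      (t.subst (Sum.elim (Term.relabel Sum.inl ∘ f) (Term.var ∘ Sum.inr))) ih
    rw [← subst_tLen, bEx, ← subst_fBound] at this
    exact this

/-- Needed to add a parameter to an induction formula without leaving `Σᵇ₁`. Substitution acts on
free variables only, so a bounding term is carried to a bounding term that still omits the bound
variable. -/
theorem InLevelOne.subst (f : α → LB.Term β) {s : Side} {φ : LB.BoundedFormula α n}
    (h : InLevelOne s φ) : InLevelOne s (φ.subst f) := by
  induction h with
  | ofSharplyBounded h => exact .ofSharplyBounded (h.subst f)
  | not _ ih => exact .not ih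
  | and _ _ ih₁ ih₂ => exact .and ih₁ ih₂
  | or _ _ ih₁ ih₂ => exact .or ih₁ ih₂
  | imp _ _ ih₁ ih₂ => exact .imp ih₁ ih₂
  | sharpAll t _ ih =>
    have := InLevelOne.sharpAll
      (t.subst (Sum.elim (Term.relabel Sum.inl ∘ f) (Term.var ∘ Sum.inr))) ih
    rw [← subst_tLen, bAll, ← subst_fBound] at this
    exact this
  | sharpEx t _ ih =>
    have := InLevelOne.sharpEx
      (t.subst (Sum.elim (Term.relabel Sum.inl ∘ f) (Term.var ∘ Sum.inr))) ih
    rw [← subst_tLen, bEx, ← subst_fBound] at this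
    exact this
  | boundedEx t _ ih =>
    have := InLevelOne.boundedEx
      (t.subst (Sum.elim (Term.relabel Sum.inl ∘ f) (Term.var ∘ Sum.inr))) ih
    rw [bEx, ← subst_fBound] at this
    exact this
  | boundedAll t _ ih =>
    have := InLevelOne.boundedAll
      (t.subst (Sum.elim (Term.relabel Sum.inl ∘ f) (Term.var ∘ Sum.inr))) ih
    rw [bAll, ← subst_fBound] at this
    exact this

end Substitution

/-! ### Absoluteness of bounded formulas and transfer of the theory to initial segments. -/

section Absoluteness

variable {M : Type*} [LB.Structure M] {N : LB.Substructure M} {α : Type} {n : ℕ}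

theorem coe_realize_term {β : Type*} (t : LB.Term β) (v : β → N) :
    ((t.realize v : N) : M) = t.realize (fun i => (v i : M)) := by
  exact (HomClass.realize_term N.subtype (t := t) (v := v)).symm

theorem le_coe (a b : N) : le (a : M) (b : M) ↔ le a b := by
  unfold le
  rw [← N.subtype.map_rel]
  refine iff_of_eq (congrArg _ ?_)
  ext i; fin_cases i <;> rfl

theorem coe_realize_term_elim (t : LB.Term (α ⊕ Fin n)) (v : α → N) (xs : Fin n → N) :
    ((t.realize (Sum.elim v xs) : N) : M) =
      t.realize (Sum.elim (fun i => (v i : M)) (fun i => (xs i : M))) := by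
  rw [coe_realize_term]
  congr 1
  ext i; cases i <;> rfl

theorem coe_snoc (xs : Fin n → N) (a : N) :
    (fun i => ((Fin.snoc xs a : Fin (n + 1) → N) i : M)) =
      Fin.snoc (fun i => (xs i : M)) (a : M) := by
  ext i; refine Fin.lastCases ?_ (fun i => ?_) i <;> simp

variable (hN : ∀ a b : M, b ∈ N → BoundedArithmetic.le a b → a ∈ N)

/-- The formula `φ` has the same meaning in `N` and in `M`. -/
def IsAbsolute (N : LB.Substructure M) (φ : LB.BoundedFormula α n) : Prop :=
  ∀ (v : α → N) (xs : Fin n → N),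
    φ.Realize v xs ↔ φ.Realize (fun i => (v i : M)) (fun i => (xs i : M))

include hN in
-- The value of the bound `t` lies in `N`, so downward closure puts every element below it in `N`:
-- both quantifiers range over the same elements.
theorem IsAbsolute.bAll (t : LB.Term (α ⊕ Fin n)) {φ : LB.BoundedFormula α (n + 1)}
    (h : IsAbsolute N φ) : IsAbsolute N (bAll t φ) := by
  intro v xs
  simp only [realize_bAll, ← coe_realize_term_elim]
  constructor
  · intro H a ha
    have := H ⟨a, hN _ _ (Subtype.prop _) ha⟩ ((le_coe _ _).1 ha)
    rwa [h, coe_snoc] at this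
  · intro H a ha
    rw [h, coe_snoc]
    exact H a ((le_coe _ _).2 ha)

include hN in
theorem IsAbsolute.bEx (t : LB.Term (α ⊕ Fin n)) {φ : LB.BoundedFormula α (n + 1)}
    (h : IsAbsolute N φ) : IsAbsolute N (bEx t φ) := by
  intro v xs
  simp only [realize_bEx, ← coe_realize_term_elim]
  constructor
  · rintro ⟨a, ha, H⟩
    rw [h, coe_snoc] at H
    exact ⟨a, (le_coe _ _).2 ha, H⟩
  · rintro ⟨a, ha, H⟩
    refine ⟨⟨a, hN _ _ (Subtype.prop _) ha⟩, (le_coe _ _).1 ha, ?_⟩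
    rwa [h, coe_snoc]

theorem IsAbsolute.not {φ : LB.BoundedFormula α n} (h : IsAbsolute N φ) : IsAbsolute N φ.not :=
  fun v xs => by simp only [BoundedFormula.realize_not, h v xs]

theorem IsAbsolute.and {φ ψ : LB.BoundedFormula α n} (h : IsAbsolute N φ) (h' : IsAbsolute N ψ) :
    IsAbsolute N (φ ⊓ ψ) :=
  fun v xs => by simp only [BoundedFormula.realize_inf, h v xs, h' v xs]

theorem IsAbsolute.or {φ ψ : LB.BoundedFormula α n} (h : IsAbsolute N φ) (h' : IsAbsolute N ψ) :
    IsAbsolute N (φ ⊔ ψ) :=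
  fun v xs => by simp only [BoundedFormula.realize_sup, h v xs, h' v xs]

theorem IsAbsolute.imp {φ ψ : LB.BoundedFormula α n} (h : IsAbsolute N φ) (h' : IsAbsolute N ψ) :
    IsAbsolute N (φ.imp ψ) :=
  fun v xs => by simp only [BoundedFormula.realize_imp, h v xs, h' v xs]

include hN in
theorem IsSharplyBounded.isAbsolute {φ : LB.BoundedFormula α n} (h : IsSharplyBounded φ) :
    IsAbsolute N φ := by
  induction h with
  | falsum => exact fun _ _ => Iff.rfl
  | equal s t =>
    intro v xs
    simp only [BoundedFormula.realize_bdEqual, ← coe_realize_term_elim, SetLike.coe_eq_coe]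
  | le s t =>
    intro v xs
    simp only [realize_fLe, ← coe_realize_term_elim, le_coe]
  | not _ ih => exact ih.not
  | and _ _ ih₁ ih₂ => exact ih₁.and ih₂
  | or _ _ ih₁ ih₂ => exact ih₁.or ih₂
  | imp _ _ ih₁ ih₂ => exact ih₁.imp ih₂
  | sharpAll t _ ih => exact ih.bAll hN _
  | sharpEx t _ ih => exact ih.bEx hN _

include hN in
theorem InLevelOne.isAbsolute {s : Side} {φ : LB.BoundedFormula α n} (h : InLevelOne s φ) :
    IsAbsolute N φ := by
  induction h with
  | ofSharplyBounded h => exact h.isAbsolute hN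
  | not _ ih => exact ih.not
  | and _ _ ih₁ ih₂ => exact ih₁.and ih₂
  | or _ _ ih₁ ih₂ => exact ih₁.or ih₂
  | imp _ _ ih₁ ih₂ => exact ih₁.imp ih₂
  | sharpAll t _ ih => exact ih.bAll hN _
  | sharpEx t _ ih => exact ih.bEx hN _
  | boundedEx t _ ih => exact ih.bEx hN _
  | boundedAll t _ ih => exact ih.bAll hN _

/-- The axioms have quantifier-free matrices, so absoluteness passes them to substructures. -/
theorem isSharplyBounded_of_mem_basicList {ψ : LB.BoundedFormula Empty 4} (h : ψ ∈ basicList) :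
    IsSharplyBounded ψ := by
  simp only [basicList, List.mem_cons, List.not_mem_nil, or_false] at h
  rcases h with rfl | rfl | rfl | rfl | rfl | rfl | rfl | rfl | rfl | rfl | rfl | rfl | rfl |
    rfl | rfl | rfl | rfl | rfl | rfl | rfl | rfl | rfl | rfl | rfl | rfl | rfl | rfl | rfl |
    rfl | rfl | rfl | rfl | rfl <;>
  repeat' first
    | exact .falsum
    | exact .equal _ _
    | exact .le _ _
    | apply IsSharplyBounded.and
    | apply IsSharplyBounded.or
    | apply IsSharplyBounded.not
    | apply IsSharplyBounded.imp

theorem realize_basic (h : M ⊨ S12) {ψ : LB.BoundedFormula Empty 4} (hψ : ψ ∈ basicList)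
    (xs : Fin 4 → M) : ψ.Realize (default : Empty → M) xs := by
  have := h.realize_of_mem ψ.alls (Or.inl ⟨ψ, hψ, rfl⟩)
  exact BoundedFormula.realize_alls.1 this xs

/-- Initial segments that are closed under the operations inherit `S¹₂`. -/
theorem models_S12_of_downward (h : M ⊨ S12)
    (hN : ∀ a b : M, b ∈ N → le a b → a ∈ N)
    (htrans : ∀ a b c : M, le a b → le b c → le a c)
    (hrefl : ∀ a : M, le a a)
    (hhalf : ∀ a : M, le (half a) a) : N ⊨ S12 := by
  refine ⟨?_⟩
  rintro σ (⟨ψ, hψ, rfl⟩ | ⟨k, φ, hφ, rfl⟩)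
  · refine BoundedFormula.realize_alls.2 fun xs => ?_
    rw [(isSharplyBounded_of_mem_basicList hψ).isAbsolute hN]
    convert realize_basic h hψ _
  · rw [models_pind]
    intro v h0 hstep a
    -- The bound `a` becomes a new parameter at position `k`, and the induction variable moves to
    -- the last position `k + 1`.
    let f : Fin (k + 1) → LB.Term (Fin (k + 2)) :=
      Fin.snoc (α := fun _ => LB.Term (Fin (k + 2))) (fun i => Term.var i.castSucc.castSucc)
        (Term.var (Fin.last _))
    let b : LB.Formula (Fin (k + 2)) :=
      fLe (n := 0) (Term.var (Sum.inl (Fin.last (k + 1))))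
        (Term.var (Sum.inl (Fin.last k).castSucc))
    -- The guard `x ≤ a` is atomic, so as an antecedent it keeps the formula in `Σᵇ₁`. It is needed
    -- because the induction step is known only for elements of `N`.
    have hψ : IsSigmaB1 (b.imp (φ.subst f)) :=
      .imp (.ofSharplyBounded (.le _ _)) (hφ.subst f)
    have hind := (models_pind _).1 (h.realize_of_mem _ (Or.inr ⟨k + 1, _, hψ, rfl⟩))
      (Fin.snoc (fun i => (v i : M)) (a : M))
    have key (x : M) : (b.imp (φ.subst f)).Realize
        (Fin.snoc (Fin.snoc (fun i => (v i : M)) (a : M) : Fin (k + 1) → M) x : Fin (k + 2) → M) ↔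
        (le x a → φ.Realize (Fin.snoc (fun i => (v i : M)) x : Fin (k + 1) → M)) := by
      have hf : (fun i => (f i).realize (Fin.snoc (Fin.snoc (fun i => (v i : M)) (a : M) :
          Fin (k + 1) → M) x : Fin (k + 2) → M)) =
          (Fin.snoc (fun i => (v i : M)) x : Fin (k + 1) → M) := by
        ext i
        refine Fin.lastCases ?_ (fun i => ?_) i
        · simp [f]
        · simp only [f, Fin.snoc_castSucc, Term.realize_var]
      simp only [Formula.Realize, BoundedFormula.realize_imp, BoundedFormula.realize_subst, hf]
      refine imp_congr_left ?_
      simp only [b, realize_fLe, Term.realize_var, Sum.elim_inl, Fin.snoc_last, Fin.snoc_castSucc]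
    have abs (x : N) : φ.Realize (Fin.snoc v x : Fin (k + 1) → N) ↔
        φ.Realize (Fin.snoc (fun i => (v i : M)) (x : M) : Fin (k + 1) → M) := by
      have := hφ.isAbsolute hN (Fin.snoc v x : Fin (k + 1) → N) default
      rw [coe_snoc] at this
      rw [Formula.Realize, this, Formula.Realize]
      exact iff_of_eq (congrArg _ (Subsingleton.elim _ _))
    simp only [key] at hind
    rw [abs]
    refine hind (fun _ => ?_) (fun x hx hxa => ?_) a (hrefl _)
    · have e : ((zero N : N) : M) = zero M := by
        have := coe_realize_term (N := N) (0 : LB.Term Empty) default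
        simpa using this
      rw [← e, ← abs]; exact h0
    · have hxN : x ∈ N := hN _ _ a.2 hxa
      have := hstep ⟨x, hxN⟩
      rw [abs, abs] at this
      refine this ?_
      have e : ((half (⟨x, hxN⟩ : N) : N) : M) = half x := by
        have := coe_realize_term (N := N) (tHalf (Term.var ())) fun _ => ⟨x, hxN⟩
        simpa [half] using this
      rw [e]
      -- The guard passes from `x` to its half because `⌊x/2⌋ ≤ x ≤ a`.
      exact hx (htrans _ _ _ (hhalf x) hxa)

end Absoluteness

/-! ### The basic axioms as statements about elements. -/

section Arithmetic

variable {M : Type*} [LB.Structure M]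

theorem S12.one_eq (h : M ⊨ S12) : one M = succ (zero M) := by
  simpa [basicList, tVar, half, smash] using
    -- The index `n` is the position in `basicList`, counted from 0; variables absent from the axiom
    -- are given the value `0`.
    realize_basic h (basicList.getElem_mem (n := 0) (by decide)) ![zero M, zero M, zero M, zero M]

theorem S12.ne_succ (h : M ⊨ S12) (a : M) : a ≠ succ a := by
  simpa [basicList, tVar, half, smash] using
    realize_basic h (basicList.getElem_mem (n := 2) (by decide)) ![a, zero M, zero M, zero M]

theorem S12.zero_le (h : M ⊨ S12) (a : M) : le (zero M) a := by
  simpa [basicList, tVar, half, smash] using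
    realize_basic h (basicList.getElem_mem (n := 3) (by decide)) ![a, zero M, zero M, zero M]

theorem S12.le_and_ne_iff (h : M ⊨ S12) (a b : M) : le a b ∧ a ≠ b ↔ le (succ a) b := by
  simpa [basicList, tVar, half, smash] using
    realize_basic h (basicList.getElem_mem (n := 4) (by decide)) ![a, b, zero M, zero M]

theorem S12.le_total (h : M ⊨ S12) (a b : M) : le a b ∨ le b a := by
  simpa [basicList, tVar, half, smash] using
    realize_basic h (basicList.getElem_mem (n := 6) (by decide)) ![a, b, zero M, zero M]

theorem S12.le_antisymm (h : M ⊨ S12) (a b : M) : le a b ∧ le b a → a = b := by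
  simpa [basicList, tVar, half, smash] using
    realize_basic h (basicList.getElem_mem (n := 7) (by decide)) ![a, b, zero M, zero M]

theorem S12.le_trans (h : M ⊨ S12) (a b c : M) : le a b ∧ le b c → le a c := by
  simpa [basicList, tVar, half, smash] using
    realize_basic h (basicList.getElem_mem (n := 8) (by decide)) ![a, b, c, zero M]

theorem S12.len_zero (h : M ⊨ S12) : len (zero M) = zero M := by
  simpa [basicList, tVar, half, smash] using
    realize_basic h (basicList.getElem_mem (n := 9) (by decide)) ![zero M, zero M, zero M, zero M]

theorem S12.len_double (h : M ⊨ S12) (a : M) :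
    a ≠ zero M → len (mul (succ (succ (zero M))) a) = succ (len a) ∧
      len (succ (mul (succ (succ (zero M))) a)) = succ (len a) := by
  simpa [basicList, tVar, half, smash] using
    realize_basic h (basicList.getElem_mem (n := 10) (by decide)) ![a, zero M, zero M, zero M]

theorem S12.len_one (h : M ⊨ S12) : len (one M) = one M := by
  simpa [basicList, tVar, half, smash] using
    realize_basic h (basicList.getElem_mem (n := 11) (by decide)) ![zero M, zero M, zero M, zero M]

theorem S12.len_mono (h : M ⊨ S12) (a b : M) : le a b → le (len a) (len b) := by
  simpa [basicList, tVar, half, smash] using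
    realize_basic h (basicList.getElem_mem (n := 12) (by decide)) ![a, b, zero M, zero M]

theorem S12.len_smash (h : M ⊨ S12) (a b : M) : len (smash a b) = succ (mul (len a) (len b)) := by
  simpa [basicList, tVar, half, smash] using
    realize_basic h (basicList.getElem_mem (n := 13) (by decide)) ![a, b, zero M, zero M]

theorem S12.zero_smash (h : M ⊨ S12) (a : M) : smash (zero M) a = one M := by
  simpa [basicList, tVar, half, smash] using
    realize_basic h (basicList.getElem_mem (n := 14) (by decide)) ![a, zero M, zero M, zero M]

theorem S12.one_smash_double (h : M ⊨ S12) (a : M) :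
    a ≠ zero M → smash (one M) (mul (succ (succ (zero M))) a) = mul (succ (succ (zero M))) (smash (one M) a) ∧
      smash (one M) (succ (mul (succ (succ (zero M))) a)) = mul (succ (succ (zero M))) (smash (one M) a) := by
  simpa [basicList, tVar, half, smash] using
    realize_basic h (basicList.getElem_mem (n := 15) (by decide)) ![a, zero M, zero M, zero M]

theorem S12.smash_comm (h : M ⊨ S12) (a b : M) : smash a b = smash b a := by
  simpa [basicList, tVar, half, smash] using
    realize_basic h (basicList.getElem_mem (n := 16) (by decide)) ![a, b, zero M, zero M]

theorem S12.smash_add (h : M ⊨ S12) (a b c d : M) :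
    len a = add (len b) (len c) → smash a d = mul (smash b d) (smash c d) := by
  simpa [basicList, tVar, half, smash] using
    realize_basic h (basicList.getElem_mem (n := 18) (by decide)) ![a, b, c, d]

theorem S12.le_add_right (h : M ⊨ S12) (a b : M) : le a (add a b) := by
  simpa [basicList, tVar, half, smash] using
    realize_basic h (basicList.getElem_mem (n := 19) (by decide)) ![a, b, zero M, zero M]

theorem S12.add_comm (h : M ⊨ S12) (a b : M) : add a b = add b a := by
  simpa [basicList, tVar, half, smash] using
    realize_basic h (basicList.getElem_mem (n := 21) (by decide)) ![a, b, zero M, zero M]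

theorem S12.add_zero (h : M ⊨ S12) (a : M) : add a (zero M) = a := by
  simpa [basicList, tVar, half, smash] using
    realize_basic h (basicList.getElem_mem (n := 22) (by decide)) ![a, zero M, zero M, zero M]

theorem S12.add_succ (h : M ⊨ S12) (a b : M) : add a (succ b) = succ (add a b) := by
  simpa [basicList, tVar, half, smash] using
    realize_basic h (basicList.getElem_mem (n := 23) (by decide)) ![a, b, zero M, zero M]

theorem S12.add_le_add_iff_left (h : M ⊨ S12) (a b c : M) : le (add a b) (add a c) ↔ le b c := by
  simpa [basicList, tVar, half, smash] using
    realize_basic h (basicList.getElem_mem (n := 25) (by decide)) ![a, b, c, zero M]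

theorem S12.mul_zero (h : M ⊨ S12) (a : M) : mul a (zero M) = zero M := by
  simpa [basicList, tVar, half, smash] using
    realize_basic h (basicList.getElem_mem (n := 26) (by decide)) ![a, zero M, zero M, zero M]

theorem S12.mul_succ (h : M ⊨ S12) (a b : M) : mul a (succ b) = add (mul a b) a := by
  simpa [basicList, tVar, half, smash] using
    realize_basic h (basicList.getElem_mem (n := 27) (by decide)) ![a, b, zero M, zero M]

theorem S12.mul_comm (h : M ⊨ S12) (a b : M) : mul a b = mul b a := by
  simpa [basicList, tVar, half, smash] using
    realize_basic h (basicList.getElem_mem (n := 28) (by decide)) ![a, b, zero M, zero M]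

theorem S12.mul_add (h : M ⊨ S12) (a b c : M) : mul a (add b c) = add (mul a b) (mul a c) := by
  simpa [basicList, tVar, half, smash] using
    realize_basic h (basicList.getElem_mem (n := 29) (by decide)) ![a, b, c, zero M]

theorem S12.mul_le_mul_iff_left (h : M ⊨ S12) (a b c : M) :
    le (one M) a → (le (mul a b) (mul a c) ↔ le b c) := by
  simpa [basicList, tVar, half, smash] using
    realize_basic h (basicList.getElem_mem (n := 30) (by decide)) ![a, b, c, zero M]

theorem S12.len_eq_succ_len_half (h : M ⊨ S12) (a : M) :
    a ≠ zero M → len a = succ (len (half a)) := by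
  simpa [basicList, tVar, half, smash] using
    realize_basic h (basicList.getElem_mem (n := 31) (by decide)) ![a, zero M, zero M, zero M]

theorem S12.eq_half_iff (h : M ⊨ S12) (a b : M) :
    a = half b ↔ mul (succ (succ (zero M))) a = b ∨ succ (mul (succ (succ (zero M))) a) = b := by
  simpa [basicList, tVar, half, smash] using
    realize_basic h (basicList.getElem_mem (n := 32) (by decide)) ![a, b, zero M, zero M]

end Arithmetic

/-! ### Order, halving, smash and powers in models of the theory. -/

section Consequences

variable {M : Type*} [LB.Structure M]

namespace S12

theorem le_refl (h : M ⊨ S12) (a : M) : le a a := (le_total h a a).elim id id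

theorem add_one (h : M ⊨ S12) (a : M) : add a (one M) = succ a := by
  rw [one_eq h, add_succ h, add_zero h]

theorem succ_zero_add_one (h : M ⊨ S12) : succ (succ (zero M)) = add (one M) (one M) := by
  rw [add_one h, ← one_eq h]

theorem le_succ (h : M ⊨ S12) (a : M) : le a (succ a) := by
  rw [← add_one h]; exact le_add_right h _ _

theorem add_le_add (h : M ⊨ S12) {a b c d : M} (hab : le a b) (hcd : le c d) :
    le (add a c) (add b d) := by
  refine le_trans h _ _ _ ⟨(add_le_add_iff_left h a c d).2 hcd, ?_⟩
  rw [add_comm h a, add_comm h b]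
  exact (add_le_add_iff_left h d a b).2 hab

theorem succ_le_succ (h : M ⊨ S12) {a b : M} (hab : le a b) : le (succ a) (succ b) := by
  rw [← add_one h, ← add_one h]; exact add_le_add h hab (le_refl h _)

theorem one_le_of_ne_zero (h : M ⊨ S12) {a : M} (ha : a ≠ zero M) : le (one M) a := by
  rw [one_eq h]; exact (le_and_ne_iff h _ _).1 ⟨zero_le h a, ha.symm⟩

theorem mul_le_mul_left (h : M ⊨ S12) (a : M) {b c : M} (hbc : le b c) :
    le (mul a b) (mul a c) := by
  by_cases ha : a = zero M
  · rw [ha, mul_comm h, mul_zero h]; exact zero_le h _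
  · exact (mul_le_mul_iff_left h a b c (one_le_of_ne_zero h ha)).2 hbc

theorem mul_le_mul (h : M ⊨ S12) {a b c d : M} (hab : le a b) (hcd : le c d) :
    le (mul a c) (mul b d) := by
  refine le_trans h _ _ _ ⟨mul_le_mul_left h a hcd, ?_⟩
  rw [mul_comm h a, mul_comm h b]
  exact mul_le_mul_left h d hab

theorem mul_one (h : M ⊨ S12) (a : M) : mul a (one M) = a := by
  rw [one_eq h, mul_succ h, mul_zero h, add_comm h, add_zero h]

theorem mul_two (h : M ⊨ S12) (a : M) : mul a (succ (succ (zero M))) = add a a := by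
  rw [succ_zero_add_one h, mul_add h, mul_one h]

theorem two_mul (h : M ⊨ S12) (a : M) : mul (succ (succ (zero M))) a = add a a := by
  rw [mul_comm h, mul_two h]

theorem eq_double_half_or (h : M ⊨ S12) (a : M) :
    a = add (half a) (half a) ∨ a = succ (add (half a) (half a)) := by
  have := (eq_half_iff h (half a) a).1 rfl
  rw [two_mul h] at this
  exact this.imp Eq.symm Eq.symm

theorem half_le (h : M ⊨ S12) (a : M) : le (half a) a := by
  have h₁ := le_add_right h (half a) (half a)
  rcases eq_double_half_or h a with h₂ | h₂
  · rwa [← h₂] at h₁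
  · have := le_trans h _ _ _ ⟨h₁, le_succ h _⟩
    rwa [← h₂] at this

/-- Polynomial induction for a sharply bounded formula. -/
theorem polynomial_induction (h : M ⊨ S12) {k : ℕ} {φ : LB.Formula (Fin (k + 1))}
    (hφ : IsSharplyBounded φ) (v : Fin k → M)
    (h₀ : φ.Realize (Fin.snoc v (zero M) : Fin (k + 1) → M))
    (h₁ : ∀ x, φ.Realize (Fin.snoc v (half x) : Fin (k + 1) → M) →
      φ.Realize (Fin.snoc v x : Fin (k + 1) → M)) (x : M) :
    φ.Realize (Fin.snoc v x : Fin (k + 1) → M) :=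
  (models_pind φ).1 (h.realize_of_mem _ (Or.inr ⟨k, φ, .ofSharplyBounded hφ, rfl⟩)) v h₀ h₁ x

theorem succ_half_le (h : M ⊨ S12) {a : M} (ha : a ≠ zero M) : le (succ (half a)) a := by
  rcases eq_double_half_or h a with h₁ | h₁
  · by_cases h₂ : half a = zero M
    · rw [h₂, add_zero h] at h₁
      exact absurd h₁ ha
    · have := (add_le_add_iff_left h (half a) _ _).2 (one_le_of_ne_zero h h₂)
      rwa [add_one h, ← h₁] at this
  · have := succ_le_succ h (le_add_right h (half a) (half a))
    rwa [← h₁] at this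

/-- Polynomial induction: for `x ≠ 0`, `|x| = |⌊x/2⌋| + 1 ≤ ⌊x/2⌋ + 1 ≤ x`. This gives closure of
the cut under length. -/
theorem len_le_self (h : M ⊨ S12) (a : M) : le (len a) a := by
  let φ : LB.Formula (Fin 1) :=
    fLe (n := 0) (tLen (Term.var (Sum.inl 0))) (Term.var (Sum.inl 0))
  have hφ (x : M) : φ.Realize (Fin.snoc (default : Fin 0 → M) x : Fin 1 → M) ↔
      le (len x) x := by
    simp [φ, Formula.Realize, Fin.snoc]
  rw [← hφ]
  refine polynomial_induction h (.le _ _) _ ?_ (fun x hx => ?_) a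
  · rw [hφ, len_zero h]; exact zero_le h _
  · rw [hφ] at hx ⊢
    by_cases hx₀ : x = zero M
    · rw [hx₀, len_zero h]; exact zero_le h _
    · rw [len_eq_succ_len_half h _ hx₀]
      exact le_trans h _ _ _ ⟨succ_le_succ h hx, succ_half_le h hx₀⟩

theorem len_two (h : M ⊨ S12) : len (succ (succ (zero M))) = succ (succ (zero M)) := by
  have h₁ : one M ≠ zero M := by
    rw [one_eq h]
    exact (ne_succ h (zero M)).symm
  have := (len_double h (one M) h₁).1
  rwa [mul_one h, len_one h, one_eq h] at this

theorem two_smash (h : M ⊨ S12) (a : M) :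
    smash (succ (succ (zero M))) a = mul (smash (one M) a) (smash (one M) a) := by
  refine smash_add h _ _ _ _ ?_
  rw [len_one h, len_two h, succ_zero_add_one h]

/-- Otherwise `0 = |0| = |a|·|b| + 1` would be a successor. -/
theorem smash_ne_zero (h : M ⊨ S12) (a b : M) : smash a b ≠ zero M := by
  intro h₁
  have h₂ := len_smash h a b
  rw [h₁, len_zero h] at h₂
  have h₃ := zero_le h (mul (len a) (len b))
  have h₄ := le_succ h (mul (len a) (len b))
  rw [← h₂] at h₄
  rw [le_antisymm h _ _ ⟨h₄, h₃⟩] at h₂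
  exact ne_succ h _ h₂

theorem mul_left_cancel (h : M ⊨ S12) {a b c : M} (ha : a ≠ zero M)
    (hbc : mul a b = mul a c) : b = c := by
  have h₁ := one_le_of_ne_zero h ha
  refine le_antisymm h _ _ ⟨(mul_le_mul_iff_left h a b c h₁).1 ?_,
    (mul_le_mul_iff_left h a c b h₁).1 ?_⟩ <;> rw [hbc] <;> exact le_refl h _

/-- Computing `1 # 2 = 2 # 1` in two ways gives `2·(1 # 1) = (1 # 1)²`; then `1 # 1` cancels. -/
theorem one_smash_one (h : M ⊨ S12) : smash (one M) (one M) = succ (succ (zero M)) := by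
  have h₁ : one M ≠ zero M := by
    rw [one_eq h]
    exact (ne_succ h (zero M)).symm
  have h₂ := (one_smash_double h (one M) h₁).1
  rw [mul_one h, smash_comm h, two_smash h, mul_comm h (succ _)] at h₂
  exact mul_left_cancel h (smash_ne_zero h _ _) h₂

/-- In the standard model this says `x < 2^|x|`. Polynomial induction: if `⌊x/2⌋ ≠ 0`, then `1 # x =
2·(1 # ⌊x/2⌋) ≥ 2·(⌊x/2⌋ + 1) ≥ x + 1`. -/
theorem succ_le_one_smash (h : M ⊨ S12) (a : M) : le (succ a) (smash (one M) a) := by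
  let φ : LB.Formula (Fin 1) :=
    fLe (n := 0) (tSucc (Term.var (Sum.inl 0))) (tSmash 1 (Term.var (Sum.inl 0)))
  have hφ (x : M) : φ.Realize (Fin.snoc (default : Fin 0 → M) x : Fin 1 → M) ↔
      le (succ x) (smash (one M) x) := by
    simp [φ, Formula.Realize, Fin.snoc, smash]
  have hzero : le (succ (zero M)) (smash (one M) (zero M)) := by
    rw [smash_comm h, zero_smash h, one_eq h]; exact le_refl h _
  rw [← hφ]
  refine polynomial_induction h (.le _ _) _ ((hφ _).2 hzero) (fun x hx => ?_) a
  rw [hφ] at hx ⊢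
  have hcases := eq_double_half_or h x
  -- The doubling axioms for `1 # x` require a nonzero half, so `x = 0` and `x = 1` are treated
  -- directly.
  by_cases h₀ : half x = zero M
  · rw [h₀, add_zero h] at hcases
    rcases hcases with rfl | rfl
    · exact hzero
    · rw [← one_eq h, one_smash_one h, ← one_eq h]; exact le_refl h _
  · have hd := one_smash_double h _ h₀
    have hle := add_le_add h hx hx
    rw [← two_mul h (smash _ _), add_succ h, add_comm h (succ _), add_succ h] at hle
    rw [two_mul h (half x)] at hd
    rcases hcases with h₁ | h₁
    · rw [← h₁] at hd hle
      rw [hd.1]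
      exact le_trans h _ _ _ ⟨le_succ h _, hle⟩
    · rw [← h₁] at hd hle
      rw [hd.2]
      exact hle

/-- Here `a·b ≤ b² ≤ (1 # b)² = 2 # b`, which bounds a product without computing its length. -/
theorem mul_le_two_smash (h : M ⊨ S12) {a b : M} (hab : le a b) :
    le (mul a b) (smash (succ (succ (zero M))) b) := by
  have hb : le b (smash (one M) b) := le_trans h _ _ _ ⟨le_succ h b, succ_le_one_smash h b⟩
  rw [two_smash h]
  exact mul_le_mul h (le_trans h _ _ _ ⟨hab, hb⟩) hb

/-- Not among the basic axioms. Polynomial induction on the third factor, written as `2y` or `2y +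
1`, reduces it to distributivity. -/
theorem mul_assoc (h : M ⊨ S12) (a b c : M) : mul (mul a b) c = mul a (mul b c) := by
  let φ : LB.Formula (Fin 3) :=
    Term.bdEqual (n := 0) (Term.var (Sum.inl 0) * Term.var (Sum.inl 1) * Term.var (Sum.inl 2))
      (Term.var (Sum.inl 0) * (Term.var (Sum.inl 1) * Term.var (Sum.inl 2)))
  have hφ (x : M) : φ.Realize (Fin.snoc ![a, b] x : Fin 3 → M) ↔
      mul (mul a b) x = mul a (mul b x) := by
    simp [φ, Formula.Realize]
  rw [← hφ]
  refine polynomial_induction h (.equal _ _) _ ?_ (fun x hx => ?_) c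
  · rw [hφ]; simp only [mul_zero h]
  · rw [hφ] at hx ⊢
    rcases eq_double_half_or h x with h₁ | h₁ <;> rw [h₁] <;>
      simp only [mul_succ h, mul_add h, hx]

theorem pow_add (h : M ⊨ S12) (a : M) (k l : ℕ) : pow a (k + l) = mul (pow a k) (pow a l) := by
  induction l with
  | zero => exact (mul_one h _).symm
  | succ l ih =>
    change mul (pow a (k + l)) a = mul (pow a k) (mul (pow a l) a)
    rw [ih, mul_assoc h]

theorem one_le_pow (h : M ⊨ S12) {a : M} (ha : le (one M) a) (k : ℕ) : le (one M) (pow a k) := by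
  induction k with
  | zero => exact le_refl h _
  | succ k ih =>
    have := mul_le_mul h ih ha
    rwa [mul_one h] at this

/-- Since `1 ≤ a^k`, one has `a^k + 1 ≤ 2·a^k ≤ a^(k+1)`: one more power absorbs a successor. -/
theorem succ_pow_le (h : M ⊨ S12) {a : M} (ha : le (succ (succ (zero M))) a) (k : ℕ) :
    le (succ (pow a k)) (pow a (k + 1)) := by
  have h₁ : le (one M) a := by
    rw [one_eq h]; exact le_trans h _ _ _ ⟨le_succ h _, ha⟩
  have h₂ := (add_le_add_iff_left h (pow a k) _ _).2 (one_le_pow h h₁ k)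
  rw [add_one h, ← mul_two h] at h₂
  exact le_trans h _ _ _ ⟨h₂, mul_le_mul_left h _ ha⟩

end S12

/-! ### The cut of elements of polynomially bounded length. -/

theorem funMap_one_eq (f : LBFunc 1) (x : Fin 1 → M) :
    Structure.funMap (L := LB) f x = Structure.funMap (L := LB) f ![x 0] := by
  congr 1; ext i; fin_cases i; rfl

theorem funMap_two_eq (f : LBFunc 2) (x : Fin 2 → M) :
    Structure.funMap (L := LB) f x = Structure.funMap (L := LB) f ![x 0, x 1] := by
  congr 1; ext i; fin_cases i <;> rfl

/-- The elements whose length is bounded by a standard power of `n`. -/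
def polyCut (n : M) : Set M := {b | ∃ k : ℕ, le (len b) (pow n k)}

section PolyCut

variable {n a b : M}

theorem polyCut_downward (h : M ⊨ S12) (hb : b ∈ polyCut n) (hab : le a b) : a ∈ polyCut n :=
  hb.imp fun _ hk => S12.le_trans h _ _ _ ⟨S12.len_mono h _ _ hab, hk⟩

theorem zero_mem_polyCut (h : M ⊨ S12) : zero M ∈ polyCut n :=
  ⟨0, by rw [S12.len_zero h]; exact S12.zero_le h _⟩

theorem one_mem_polyCut (h : M ⊨ S12) : one M ∈ polyCut n :=
  ⟨0, by rw [S12.len_one h]; exact S12.le_refl h _⟩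

variable (hn : le (succ (succ (zero M))) n)

include hn

theorem add_mem_polyCut (h : M ⊨ S12) (ha : a ∈ polyCut n) (hb : b ∈ polyCut n) :
    add a b ∈ polyCut n := by
  -- By monotonicity it suffices to double the larger summand, and for `c ≠ 0` doubling raises the
  -- length by exactly one.
  have double (c : M) (hc : c ∈ polyCut n) : add c c ∈ polyCut n := by
    by_cases h₀ : c = zero M
    · rw [h₀, S12.add_zero h]; exact zero_mem_polyCut h
    · obtain ⟨k, hk⟩ := hc
      refine ⟨k + 1, ?_⟩
      rw [← S12.two_mul h, (S12.len_double h c h₀).1]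
      exact S12.le_trans h _ _ _ ⟨S12.succ_le_succ h hk, S12.succ_pow_le h hn k⟩
  rcases S12.le_total h a b with hab | hab
  · exact polyCut_downward h (double b hb) (S12.add_le_add h hab (S12.le_refl h b))
  · exact polyCut_downward h (double a ha) (S12.add_le_add h (S12.le_refl h a) hab)

theorem succ_mem_polyCut (h : M ⊨ S12) (ha : a ∈ polyCut n) : succ a ∈ polyCut n := by
  rw [← S12.add_one h]; exact add_mem_polyCut hn h ha (one_mem_polyCut h)

theorem smash_mem_polyCut (h : M ⊨ S12) (ha : a ∈ polyCut n) (hb : b ∈ polyCut n) :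
    smash a b ∈ polyCut n := by
  obtain ⟨k, hk⟩ := ha
  obtain ⟨l, hl⟩ := hb
  refine ⟨k + l + 1, ?_⟩
  have := S12.mul_le_mul h hk hl
  rw [← S12.pow_add h] at this
  rw [S12.len_smash h]
  exact S12.le_trans h _ _ _ ⟨S12.succ_le_succ h this, S12.succ_pow_le h hn _⟩

theorem mul_mem_polyCut (h : M ⊨ S12) (ha : a ∈ polyCut n) (hb : b ∈ polyCut n) :
    mul a b ∈ polyCut n := by
  have h₂ : succ (succ (zero M)) ∈ polyCut n :=
    succ_mem_polyCut hn h (succ_mem_polyCut hn h (zero_mem_polyCut h))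
  rcases S12.le_total h a b with hab | hab
  · exact polyCut_downward h (smash_mem_polyCut hn h h₂ hb) (S12.mul_le_two_smash h hab)
  · rw [S12.mul_comm h]
    exact polyCut_downward h (smash_mem_polyCut hn h h₂ ha) (S12.mul_le_two_smash h hab)

/-- `polyCut n` as a substructure. -/
def polyCutSubstructure (h : M ⊨ S12) : LB.Substructure M where
  carrier := polyCut n
  fun_mem {k} f x hx := by
    cases f with
    | zero => rw [Subsingleton.elim x ![] ]; exact zero_mem_polyCut h
    | one => rw [Subsingleton.elim x ![] ]; exact one_mem_polyCut h
    | succ => rw [funMap_one_eq]; exact succ_mem_polyCut hn h (hx 0)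
    | half => rw [funMap_one_eq]; exact polyCut_downward h (hx 0) (S12.half_le h _)
    | len => rw [funMap_one_eq]; exact polyCut_downward h (hx 0) (S12.len_le_self h _)
    | add => rw [funMap_two_eq]; exact add_mem_polyCut hn h (hx 0) (hx 1)
    | mul => rw [funMap_two_eq]; exact mul_mem_polyCut hn h (hx 0) (hx 1)
    | smash => rw [funMap_two_eq]; exact smash_mem_polyCut hn h (hx 0) (hx 1)

end PolyCut

end Consequences

/-! ### Numerals, lengths and powers computed in a substructure. -/

section Coercions

variable {M : Type*} [LB.Structure M] {N : LB.Substructure M}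

theorem coe_numeral (k : ℕ) : ((numeral N k : N) : M) = numeral M k := by
  induction k with
  | zero => simpa [numeral] using coe_realize_term (N := N) (0 : LB.Term Empty) default
  | succ k ih =>
    have := coe_realize_term (N := N) (tSucc (Term.var ())) fun _ => numeral N k
    simpa [numeral, ih] using this

theorem coe_len (a : N) : ((len a : N) : M) = len (a : M) := by
  simpa using coe_realize_term (N := N) (tLen (Term.var ())) fun _ => a

theorem coe_pow (a : N) (k : ℕ) : ((pow a k : N) : M) = pow (a : M) k := by
  induction k with
  | zero => simpa [pow] using coe_realize_term (N := N) (1 : LB.Term Empty) default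
  | succ k ih =>
    have := coe_realize_term (N := N) (Term.var true * Term.var false)
      fun i => cond i (pow a k) a
    simpa [pow, ih] using this

end Coercions

theorem two_le_len_of_isNonstandard {M : Type*} [LB.Structure M] (h : M ⊨ S12) {e : M}
    (he : IsNonstandard e) : le (succ (succ (zero M))) (len e) := by
  rw [← S12.len_two h]
  -- Since `e` is neither `0` nor `1`, discreteness of the order gives `2 ≤ e`, and `|2| = 2`.
  refine S12.len_mono h _ _ ((S12.le_and_ne_iff h _ _).1 ⟨?_, (he 1).symm⟩)
  exact (S12.le_and_ne_iff h _ _).1 ⟨S12.zero_le h e, (he 0).symm⟩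

end BoundedArithmetic

open BoundedArithmetic in
theorem mainTheorem6 {M₀ : Type*} [BoundedArithmetic.LB.Structure M₀] [Countable M₀]
    (hmodel : M₀ ⊨ BoundedArithmetic.S12) (hns : BoundedArithmetic.IsNonstandardModel M₀) :
    ∃ M : BoundedArithmetic.LB.Substructure M₀,
      BoundedArithmetic.IsCut (M : Set M₀) ∧ Countable M ∧ M ⊨ BoundedArithmetic.S12 ∧
      ∃ n e : M, BoundedArithmetic.IsNonstandard e ∧ n = BoundedArithmetic.len e ∧
        ∀ b : M, ∃ k : ℕ,
          BoundedArithmetic.le (BoundedArithmetic.len b) (BoundedArithmetic.pow n k) := by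
  obtain ⟨e, he⟩ := hns
  have hn := two_le_len_of_isNonstandard hmodel he
  have heN : e ∈ polyCut (len e) := by
    -- The exponent 1 suffices, as `n^1` unfolds to `1·n`.
    refine ⟨1, ?_⟩
    change BoundedArithmetic.le (len e) (mul (one M₀) (len e))
    rw [S12.mul_comm hmodel, S12.mul_one hmodel]
    exact S12.le_refl hmodel _
  let N := polyCutSubstructure hn hmodel
  refine ⟨N, ⟨⟨e, heN⟩, fun a b hb hab => polyCut_downward hmodel hb hab.1,
    fun a ha => add_mem_polyCut hn hmodel ha (one_mem_polyCut hmodel)⟩, Subtype.countable,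
    models_S12_of_downward hmodel (fun a b hb hab => polyCut_downward hmodel hb hab)
      (fun a b c hab hbc => S12.le_trans hmodel a b c ⟨hab, hbc⟩) (S12.le_refl hmodel)
      (S12.half_le hmodel), len ⟨e, heN⟩, ⟨e, heN⟩, fun k hk => he k ?_, rfl, fun b => ?_⟩
  -- Numerals have the same value in `N` and `M₀`, so `e` remains nonstandard in `N`.
  · rw [← coe_numeral (N := N), ← hk]
  · obtain ⟨k, hk⟩ := b.2
    refine ⟨k, (le_coe _ _).1 ?_⟩
    rw [coe_len, coe_pow, coe_len]
    exact hk
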